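/- Let $\Gamma$ be an invertible constant complex $n\times n$ matrix such that $\Gamma$ and $-\Gamma^\dagger$ have no eigenvalue in common ($\dagger$ denotes the conjugate transpose, ${}^*$ complex conjugation). Let $D\subseteq\mathbb{R}^2$ be open (for instance $D=\mathbb{R}^2$) and let $u: D\to\mathbb{C}$ be a smooth solution of the Fokas--Lenells equation $$u_{xt}-u-2\mathrm{i}\,|u|^2u_x=0 .$$ Let $\eta_1,\tilde\eta_2: D\to\mathbb{C}^n$ be smooth column vector solutions of the linear system $$\Gamma\,\eta_{1x}+\tfrac12\eta_1-u_x\,\tilde\eta_2=0,\qquad \eta_{1t}-\big(\mathrm{i}|u|^2I-\tfrac12\Gamma\big)\eta_1-u\,\tilde\eta_2=0,$$ $$\Gamma\,\tilde\eta_{2x}-\tfrac12\tilde\eta_2+\mathrm{i}\,u_x^*\,\Gamma\eta_1=0,\qquad \tilde\eta_{2t}+\big(\mathrm{i}|u|^2I-\tfrac12\Gamma\big)\tilde\eta_2-\mathrm{i}\,u^*\,\Gamma\eta_1=0,$$ and let $\Omega$ be an $n\times n$ matrix-valued function on $D$ solving the Lyapunov equation $$\Gamma\Omega+\Omega\Gamma^\dagger=\mathrm{i}\,\eta_1\eta_1^\dagger\Gamma^\dagger+\tilde\eta_2\tilde\eta_2^\dagger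 .$$ Then, on any open set $U\subseteq D$ on which $\Omega$ is invertible, the function $$u'=u-\tilde\eta_2^\dagger\,\Omega^{-1}\eta_1$$ is smooth and solves the Fokas--Lenells equation. -/

import Mathlib

open scoped ContDiff Matrix

/-- Partial derivative with respect to the first variable `x` at the point `p = (x, t)`. -/
noncomputable def partialX {E : Type*} [NormedAddCommGroup E] [NormedSpace ℝ E]
    (f : ℝ × ℝ → E) (p : ℝ × ℝ) : E :=
  deriv (fun s : ℝ => f (s, p.2)) p.1

/-- Partial derivative with respect to the second variable `t` at the point `p = (x, t)`. -/
noncomputable def partialT {E : Type*} [NormedAddCommGroup E] [NormedSpace ℝ E]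
    (f : ℝ × ℝ → E) (p : ℝ × ℝ) : E :=
  deriv (fun s : ℝ => f (p.1, s)) p.2

/-- `u` is a smooth solution on the (open) set `D` of the Fokas-Lenells equation
`u_xt - u - 2 i |u|² u_x = 0`. -/
def IsFokasLenellsSolutionOn (D : Set (ℝ × ℝ)) (u : ℝ × ℝ → ℂ) : Prop :=
  ContDiffOn ℝ ∞ u D ∧
    ∀ p ∈ D, partialT (partialX u) p - u p
      - 2 * Complex.I * ((‖u p‖ : ℂ) ^ 2) * partialX u p = 0

/-- `η₁, η₂` are smooth column vectors on the (open) set `D` that solve the linear system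
associated with the matrix `Γ` and the function `u`. -/
structure IsLinearSystemSolutionOn {n : ℕ} (D : Set (ℝ × ℝ)) (Γ : Matrix (Fin n) (Fin n) ℂ)
    (u : ℝ × ℝ → ℂ) (η₁ η₂ : ℝ × ℝ → Fin n → ℂ) : Prop where
  smooth₁ : ContDiffOn ℝ ∞ η₁ D
  smooth₂ : ContDiffOn ℝ ∞ η₂ D
  eq_x₁ : ∀ p ∈ D,
    Γ *ᵥ partialX η₁ p + (1 / 2 : ℂ) • η₁ p - partialX u p • η₂ p = 0
  eq_t₁ : ∀ p ∈ D,
    partialT η₁ p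
      - ((Complex.I * (‖u p‖ : ℂ) ^ 2) • (1 : Matrix (Fin n) (Fin n) ℂ) - (1 / 2 : ℂ) • Γ) *ᵥ η₁ p
      - u p • η₂ p = 0
  eq_x₂ : ∀ p ∈ D,
    Γ *ᵥ partialX η₂ p - (1 / 2 : ℂ) • η₂ p
      + (Complex.I * star (partialX u p)) • (Γ *ᵥ η₁ p) = 0
  eq_t₂ : ∀ p ∈ D,
    partialT η₂ p
      + ((Complex.I * (‖u p‖ : ℂ) ^ 2) • (1 : Matrix (Fin n) (Fin n) ℂ) - (1 / 2 : ℂ) • Γ) *ᵥ η₂ p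
      - (Complex.I * star (u p)) • (Γ *ᵥ η₁ p) = 0

/-- The function `u' = u - η₂† Ω⁻¹ η₁`. -/
noncomputable def darbouxTransform {n : ℕ} (u : ℝ × ℝ → ℂ) (η₁ η₂ : ℝ × ℝ → Fin n → ℂ)
    (Ω : ℝ × ℝ → Matrix (Fin n) (Fin n) ℂ) (p : ℝ × ℝ) : ℂ :=
  u p - star (η₂ p) ⬝ᵥ ((Ω p)⁻¹ *ᵥ η₁ p)

/-! Since `Γ` and `-Γ†` share no eigenvalue, `M ↦ ΓM + MΓ†` is injective. A continuous left inverse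
`T` recovers `Ω` from the right side of the Lyapunov equation, so `Ω` is smooth, and any claim about
its derivatives or adjoint need only be checked after applying this operator. This gives `Ω_x` and
`Ω_t` as sums of rank-one matrices, and `Ω† = Ω - i η₁η₁†`.

Write `B(x, y) = xᵀ Ω⁻¹ y`. Conjugating the Lyapunov equation by `Ω⁻¹` gives quadratic relations
between values of `B` (`toBilin_inv_of_lyapunov`), and the adjoint relation expresses the conjugate
of `B(η₂†, η₁)`. With these, `u'_x` factors as `(1 - i B(η₁†, η₁)) (u_x (1 - B(η₂†, Γ⁻¹η₂)) + B(η₂†,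
Γ⁻¹η₁))`, and the `t`-derivative of this product is `u' + 2i|u'|² u'_x`. -/

section
open scoped Matrix.Norms.Operator

/-! ### Uniqueness for the Sylvester equation. -/

/-- If `A` and `B` have no common eigenvalue, a matrix intertwining them vanishes. -/
theorem Matrix.eq_zero_of_mul_eq_mul {n : ℕ} (A B M : Matrix (Fin n) (Fin n) ℂ)
    (hspec : ¬ ∃ μ : ℂ, Module.End.HasEigenvalue (Matrix.toLin' A) μ ∧
      Module.End.HasEigenvalue (Matrix.toLin' B) μ)
    (h : A * M = M * B) : M = 0 := by
  have hpoly : ∀ p : Polynomial ℂ, Polynomial.aeval A p * M = M * Polynomial.aeval B p := by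
    intro p
    induction p using Polynomial.induction_on' with
    | add p q hp hq => simp [add_mul, mul_add, hp, hq]
    | monomial k c =>
      have hk : A ^ k * M = M * B ^ k := by
        induction k with
        | zero => simp
        | succ k ih => rw [pow_succ', mul_assoc, ih, ← mul_assoc, h, mul_assoc, ← pow_succ']
      simp [Polynomial.aeval_monomial, hk, Algebra.algebraMap_eq_smul_one]
  -- The characteristic polynomial of `B` at `A` is a product of factors `A - μ` over eigenvalues
  -- `μ` of `B`, none of them eigenvalues of `A`. It also kills `M`, by `hpoly` and Cayley–Hamilton.
  have hunit : IsUnit (Polynomial.aeval A B.charpoly) := by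
    by_contra hn
    rw [(IsAlgClosed.splits B.charpoly).eq_prod_roots_of_monic (Matrix.charpoly_monic B)] at hn
    obtain ⟨k, hk, hroot⟩ := spectrum.exists_mem_of_not_isUnit_aeval_prod hn
    refine hspec ⟨k, ?_, ?_⟩
    · rw [Module.End.hasEigenvalue_iff_mem_spectrum, Matrix.spectrum_toLin']
      exact hk
    · rw [Module.End.hasEigenvalue_iff_isRoot_charpoly, Matrix.charpoly_toLin']
      exact hroot
  have h0 := hpoly B.charpoly
  rw [Matrix.aeval_self_charpoly, mul_zero] at h0
  exact (hunit.mul_right_eq_zero).1 h0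

/-- Linearity over `ℝ` suffices, as `T` is only composed with functions of real variables. -/
theorem exists_sylvester_leftInverse {n : ℕ} (Γ : Matrix (Fin n) (Fin n) ℂ)
    (hspec : ¬ ∃ μ : ℂ, Module.End.HasEigenvalue (Matrix.toLin' Γ) μ ∧
      Module.End.HasEigenvalue (Matrix.toLin' (-Γᴴ)) μ) :
    ∃ T : Matrix (Fin n) (Fin n) ℂ →L[ℝ] Matrix (Fin n) (Fin n) ℂ,
      ∀ M, T (Γ * M + M * Γᴴ) = M := by
  let S : Matrix (Fin n) (Fin n) ℂ →ₗ[ℝ] Matrix (Fin n) (Fin n) ℂ :=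
    LinearMap.mulLeft ℝ Γ + LinearMap.mulRight ℝ Γᴴ
  have hS : LinearMap.ker S = ⊥ := by
    rw [LinearMap.ker_eq_bot']
    intro M hM
    refine Matrix.eq_zero_of_mul_eq_mul Γ (-Γᴴ) M hspec ?_
    rw [mul_neg, eq_neg_iff_add_eq_zero]
    exact hM
  obtain ⟨T, hT⟩ := LinearMap.exists_leftInverse_of_injective S hS
  exact ⟨LinearMap.toContinuousLinearMap T, fun M => LinearMap.congr_fun hT M⟩

/-! ### Product rules for vectors, matrices and inverses. -/

theorem HasDerivAt.dotProduct {n : ℕ} {x y : ℝ → Fin n → ℂ} {x' y' : Fin n → ℂ} {t : ℝ}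
    (hx : HasDerivAt x x' t) (hy : HasDerivAt y y' t) :
    HasDerivAt (fun s => x s ⬝ᵥ y s) (x' ⬝ᵥ y t + x t ⬝ᵥ y') t := by
  simp only [_root_.dotProduct, ← Finset.sum_add_distrib]
  exact HasDerivAt.fun_sum fun i _ => (hasDerivAt_pi.1 hx i).mul (hasDerivAt_pi.1 hy i)

theorem HasDerivAt.matrix_mulVec {n : ℕ} {M : ℝ → Matrix (Fin n) (Fin n) ℂ}
    {M' : Matrix (Fin n) (Fin n) ℂ} {y : ℝ → Fin n → ℂ} {y' : Fin n → ℂ} {t : ℝ}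
    (hM : HasDerivAt M M' t) (hy : HasDerivAt y y' t) :
    HasDerivAt (fun s => M s *ᵥ y s) (M' *ᵥ y t + M t *ᵥ y') t := by
  rw [hasDerivAt_pi]
  intro i
  let R : Matrix (Fin n) (Fin n) ℂ →L[ℝ] (Fin n → ℂ) :=
    LinearMap.toContinuousLinearMap (LinearMap.proj (R := ℝ) (φ := fun _ => Fin n → ℂ) i)
  exact HasDerivAt.dotProduct (R.hasFDerivAt.comp_hasDerivAt t hM) hy

theorem HasDerivAt.vecMulVec {n : ℕ} {x y : ℝ → Fin n → ℂ} {x' y' : Fin n → ℂ} {t : ℝ}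
    (hx : HasDerivAt x x' t) (hy : HasDerivAt y y' t) :
    HasDerivAt (fun s => Matrix.vecMulVec (x s) (y s))
      (Matrix.vecMulVec x' (y t) + Matrix.vecMulVec (x t) y') t := by
  have h : HasDerivAt (F := Fin n → Fin n → ℂ) (fun s i j => x s i * y s j)
      (fun i j => x' i * y t j + x t i * y' j) t :=
    hasDerivAt_pi.2 fun i => hasDerivAt_pi.2 fun j =>
      (hasDerivAt_pi.1 hx i).mul (hasDerivAt_pi.1 hy j)
  exact h

/-- Derivative of the bilinear pairing with the inverse of a matrix function. -/
theorem HasDerivAt.dotProduct_inv_mulVec {n : ℕ} {Ω : ℝ → Matrix (Fin n) (Fin n) ℂ}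
    {Ω' : Matrix (Fin n) (Fin n) ℂ} {x y : ℝ → Fin n → ℂ} {x' y' : Fin n → ℂ} {t : ℝ}
    (hΩ : HasDerivAt Ω Ω' t) (hinv : IsUnit (Ω t))
    (hx : HasDerivAt x x' t) (hy : HasDerivAt y y' t) :
    HasDerivAt (fun s => x s ⬝ᵥ ((Ω s)⁻¹ *ᵥ y s))
      (x' ⬝ᵥ ((Ω t)⁻¹ *ᵥ y t) - x t ⬝ᵥ (((Ω t)⁻¹ * Ω' * (Ω t)⁻¹) *ᵥ y t)
        + x t ⬝ᵥ ((Ω t)⁻¹ *ᵥ y')) t := by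
  have hW : HasDerivAt (fun s => (Ω s)⁻¹) (-((Ω t)⁻¹ * Ω' * (Ω t)⁻¹)) t := by
    obtain ⟨w, hw⟩ := hinv
    have h1 := hasFDerivAt_ringInverse (𝕜 := ℝ) w
    rw [hw] at h1
    have h2 := h1.comp_hasDerivAt t hΩ
    simp only [Matrix.nonsing_inv_eq_ringInverse]
    refine h2.congr_deriv ?_
    simp [← hw]
  convert hx.dotProduct (hW.matrix_mulVec hy) using 1
  simp only [Matrix.neg_mulVec, dotProduct_add, dotProduct_neg]
  ring

end

/-! ### Consequences of the Lyapunov equation for `Ω` and `Ω⁻¹`. -/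

section
open scoped Matrix.Norms.Operator

/-- The Lyapunov equation can be differentiated along a curve. -/
theorem hasDerivAt_of_lyapunov {n : ℕ} {Γ : Matrix (Fin n) (Fin n) ℂ}
    {T : Matrix (Fin n) (Fin n) ℂ →L[ℝ] Matrix (Fin n) (Fin n) ℂ}
    (hT : ∀ M, T (Γ * M + M * Γᴴ) = M)
    {a b : ℝ → Fin n → ℂ} {a' b' : Fin n → ℂ} {Ω : ℝ → Matrix (Fin n) (Fin n) ℂ}
    {M : Matrix (Fin n) (Fin n) ℂ} {t : ℝ}
    (ha : HasDerivAt a a' t) (hb : HasDerivAt b b' t)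
    (hΩ : ∀ᶠ s in nhds t, Γ * Ω s + Ω s * Γᴴ =
      Complex.I • (Matrix.vecMulVec (a s) (star (a s)) * Γᴴ) + Matrix.vecMulVec (b s) (star (b s)))
    (hM : Γ * M + M * Γᴴ =
      Complex.I • ((Matrix.vecMulVec a' (star (a t)) + Matrix.vecMulVec (a t) (star a')) * Γᴴ)
        + (Matrix.vecMulVec b' (star (b t)) + Matrix.vecMulVec (b t) (star b'))) :
    HasDerivAt Ω M t := by
  have hR := (((ha.vecMulVec ha.star).mul_const Γᴴ).const_smul Complex.I).add
    (hb.vecMulVec hb.star)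
  have h := T.hasFDerivAt.comp_hasDerivAt t hR
  -- Differentiability of `Ω` is not assumed: near `t`, `Ω` equals `T` of the differentiable right
  -- side.
  refine (h.congr_deriv ((congrArg T hM.symm).trans (hT M))).congr_of_eventuallyEq ?_
  filter_upwards [hΩ] with s hs
  rw [← hT (Ω s), hs]
  rfl

variable {n : ℕ}

theorem toBilin_mul_vecMulVec_mul (W : Matrix (Fin n) (Fin n) ℂ) (c d x y : Fin n → ℂ) :
    Matrix.toBilin' (W * Matrix.vecMulVec c d * W) x y =
      Matrix.toBilin' W x c * Matrix.toBilin' W d y := by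
  simp only [Matrix.toBilin'_apply', ← Matrix.mulVec_mulVec, Matrix.vecMulVec_mulVec,
    Matrix.mulVec_smul, dotProduct_smul, op_smul_eq_smul, smul_eq_mul]
  ring

/-- Multiply the Lyapunov equation by `Ω⁻¹` on both sides; each rank-one term then splits into a
product of two scalars. -/
theorem toBilin_inv_of_lyapunov {Γ Ω : Matrix (Fin n) (Fin n) ℂ} {a b : Fin n → ℂ}
    (hΩ : Γ * Ω + Ω * Γᴴ =
      Complex.I • (Matrix.vecMulVec a (star a) * Γᴴ) + Matrix.vecMulVec b (star b))
    (hinv : IsUnit Ω) (x y : Fin n → ℂ) :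
    Matrix.toBilin' Ω⁻¹ x (Γ *ᵥ y) + Matrix.toBilin' Ω⁻¹ (x ᵥ* Γᴴ) y =
      Complex.I * Matrix.toBilin' Ω⁻¹ x a * Matrix.toBilin' Ω⁻¹ (star a ᵥ* Γᴴ) y
        + Matrix.toBilin' Ω⁻¹ x b * Matrix.toBilin' Ω⁻¹ (star b) y := by
  have hd : IsUnit Ω.det := (Matrix.isUnit_iff_isUnit_det Ω).1 hinv
  have h1 : Ω⁻¹ * Γ + Γᴴ * Ω⁻¹ = Ω⁻¹ * (Γ * Ω + Ω * Γᴴ) * Ω⁻¹ := by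
    rw [mul_add, add_mul, ← mul_assoc, Matrix.mul_nonsing_inv_cancel_right _ _ hd,
      Matrix.nonsing_inv_mul_cancel_left _ _ hd]
  have h2 := congrArg (fun M => Matrix.toBilin' M x y) (h1.trans (by rw [hΩ]))
  simp only [mul_add, add_mul, map_add, LinearMap.add_apply, mul_smul_comm, smul_mul_assoc,
    map_smul, LinearMap.smul_apply, Matrix.vecMulVec_mul, toBilin_mul_vecMulVec_mul,
    smul_eq_mul] at h2
  rw [mul_assoc, ← h2]
  simp only [Matrix.toBilin'_apply', ← Matrix.mulVec_mulVec, Matrix.dotProduct_mulVec,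
    Matrix.vecMul_vecMul]

/-- Both sides have the same image under `M ↦ ΓM + MΓ†`, which is injective. -/
theorem conjTranspose_of_lyapunov {Γ Ω : Matrix (Fin n) (Fin n) ℂ} {a b : Fin n → ℂ}
    {T : Matrix (Fin n) (Fin n) ℂ →L[ℝ] Matrix (Fin n) (Fin n) ℂ}
    (hT : ∀ M, T (Γ * M + M * Γᴴ) = M)
    (hΩ : Γ * Ω + Ω * Γᴴ =
      Complex.I • (Matrix.vecMulVec a (star a) * Γᴴ) + Matrix.vecMulVec b (star b)) :
    Ωᴴ = Ω - Complex.I • Matrix.vecMulVec a (star a) := by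
  have h := congrArg Matrix.conjTranspose hΩ
  simp only [Matrix.conjTranspose_add, Matrix.conjTranspose_mul, Matrix.conjTranspose_smul,
    Matrix.conjTranspose_vecMulVec, Matrix.conjTranspose_conjTranspose, star_star] at h
  rw [← hT Ωᴴ, ← hT (Ω - _)]
  congr 1
  rw [add_comm, h, mul_sub, sub_mul, sub_add_sub_comm, hΩ]
  simp
  abel

/-- How the pairing with `Ω⁻¹` behaves under conjugation. -/
theorem star_toBilin_inv_of_lyapunov {Γ Ω : Matrix (Fin n) (Fin n) ℂ} {a b : Fin n → ℂ}
    {T : Matrix (Fin n) (Fin n) ℂ →L[ℝ] Matrix (Fin n) (Fin n) ℂ}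
    (hT : ∀ M, T (Γ * M + M * Γᴴ) = M)
    (hΩ : Γ * Ω + Ω * Γᴴ =
      Complex.I • (Matrix.vecMulVec a (star a) * Γᴴ) + Matrix.vecMulVec b (star b))
    (hinv : IsUnit Ω) (y : Fin n → ℂ) :
    (1 - Complex.I * Matrix.toBilin' Ω⁻¹ (star a) a) * star (Matrix.toBilin' Ω⁻¹ (star y) a)
      = Matrix.toBilin' Ω⁻¹ (star a) y := by
  have hd : IsUnit Ω.det := (Matrix.isUnit_iff_isUnit_det Ω).1 hinv
  have hdH : IsUnit Ωᴴ.det := by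
    rw [Matrix.det_conjTranspose]; exact hd.star
  -- The adjoint relation, multiplied by `Ω⁻¹` on the left and `(Ω†)⁻¹` on the right.
  have h1 : Ω⁻¹ = Ω⁻¹ᴴ - Complex.I • (Ω⁻¹ * Matrix.vecMulVec a (star a) * Ω⁻¹ᴴ) := by
    have : Ω⁻¹ * Ωᴴ * Ωᴴ⁻¹ = Ω⁻¹ := Matrix.mul_nonsing_inv_cancel_right _ _ hdH
    nth_rw 1 [conjTranspose_of_lyapunov hT hΩ] at this
    conv_lhs => rw [← this]
    rw [Matrix.conjTranspose_nonsing_inv, mul_sub, sub_mul, Matrix.nonsing_inv_mul _ hd, one_mul,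
      mul_smul_comm, smul_mul_assoc]
  have hst : star (Matrix.toBilin' Ω⁻¹ (star y) a) = Matrix.toBilin' Ω⁻¹ᴴ (star a) y := by
    rw [Matrix.toBilin'_apply', Matrix.toBilin'_apply', Matrix.dotProduct_mulVec (star a),
      ← Matrix.star_mulVec, ← Matrix.star_dotProduct]
  rw [hst]
  conv_rhs => rw [h1]
  simp only [map_sub, map_smul, LinearMap.sub_apply, LinearMap.smul_apply, smul_eq_mul]
  simp only [Matrix.toBilin'_apply', ← Matrix.mulVec_mulVec, Matrix.vecMulVec_mulVec,
    Matrix.mulVec_smul, dotProduct_smul, op_smul_eq_smul, smul_eq_mul]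
  ring

theorem HasDerivAt.toBilin_inv {Ω : ℝ → Matrix (Fin n) (Fin n) ℂ}
    {Ω' : Matrix (Fin n) (Fin n) ℂ} {x y : ℝ → Fin n → ℂ} {x' y' : Fin n → ℂ} {t : ℝ}
    (hΩ : HasDerivAt Ω Ω' t) (hinv : IsUnit (Ω t))
    (hx : HasDerivAt x x' t) (hy : HasDerivAt y y' t) :
    HasDerivAt (fun s => Matrix.toBilin' (Ω s)⁻¹ (x s) (y s))
      (Matrix.toBilin' (Ω t)⁻¹ x' (y t)
        - Matrix.toBilin' ((Ω t)⁻¹ * Ω' * (Ω t)⁻¹) (x t) (y t)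
        + Matrix.toBilin' (Ω t)⁻¹ (x t) y') t := by
  simp only [Matrix.toBilin'_apply']
  exact hΩ.dotProduct_inv_mulVec hinv hx hy

end

/-! ### Closed forms for `Ω_x` and `Ω_t`. -/

section
variable {n : ℕ}

/-- Once the image of `i a' a†` is subtracted from the right side, the terms in `v` cancel. What is
left is `½(β b† + b β†)`, the image of `½ β β†`. -/
theorem lyapunov_derivX (Γ : Matrix (Fin n) (Fin n) ℂ) {a b α β a' b' : Fin n → ℂ} {v : ℂ}
    (hα : Γ *ᵥ α = a) (hβ : Γ *ᵥ β = b)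
    (ha : a' = v • β - (1 / 2 : ℂ) • α)
    (hb : b' = (1 / 2 : ℂ) • β - (Complex.I * star v) • a) :
    Γ * (Complex.I • Matrix.vecMulVec a' (star a) + (1 / 2 : ℂ) • Matrix.vecMulVec β (star β))
      + (Complex.I • Matrix.vecMulVec a' (star a)
        + (1 / 2 : ℂ) • Matrix.vecMulVec β (star β)) * Γᴴ =
      Complex.I • ((Matrix.vecMulVec a' (star a) + Matrix.vecMulVec a (star a')) * Γᴴ)
        + (Matrix.vecMulVec b' (star b) + Matrix.vecMulVec b (star b')) := by
  have hα' : star α ᵥ* Γᴴ = star a := by rw [← hα, Matrix.star_mulVec]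
  have hβ' : star β ᵥ* Γᴴ = star b := by rw [← hβ, Matrix.star_mulVec]
  subst ha hb
  simp only [mul_add, mul_sub, add_mul, sub_mul, mul_smul_comm, smul_mul_assoc, Matrix.mul_vecMulVec,
    Matrix.vecMulVec_mul, star_sub, star_smul,
    Matrix.sub_vecMulVec, Matrix.smul_vecMulVec, Matrix.vecMulVec_sub,
    Matrix.vecMulVec_smul,
    hα, hβ, hα', hβ', star_mul', Complex.conj_conj, Complex.star_def, Complex.conj_I,
    map_div₀, map_one, map_ofNat]
  match_scalars <;> ring_nf

/-- The terms in `k = |u|²` cancel because `k` is real, so the candidate for `Ω_t` does not contain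
it. -/
theorem lyapunov_derivT (Γ : Matrix (Fin n) (Fin n) ℂ) {a b a' b' : Fin n → ℂ} {q k : ℂ}
    (hk : star k = k)
    (ha : a' = (Complex.I * k) • a - (1 / 2 : ℂ) • (Γ *ᵥ a) + q • b)
    (hb : b' = (1 / 2 : ℂ) • (Γ *ᵥ b) - (Complex.I * k) • b + (Complex.I * star q) • (Γ *ᵥ a)) :
    Γ * ((-Complex.I / 2) • Matrix.vecMulVec a (star a ᵥ* Γᴴ)
        + (Complex.I * star q) • Matrix.vecMulVec a (star b)
        + (1 / 2 : ℂ) • Matrix.vecMulVec b (star b))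
      + ((-Complex.I / 2) • Matrix.vecMulVec a (star a ᵥ* Γᴴ)
        + (Complex.I * star q) • Matrix.vecMulVec a (star b)
        + (1 / 2 : ℂ) • Matrix.vecMulVec b (star b)) * Γᴴ =
      Complex.I • ((Matrix.vecMulVec a' (star a) + Matrix.vecMulVec a (star a')) * Γᴴ)
        + (Matrix.vecMulVec b' (star b) + Matrix.vecMulVec b (star b')) := by
  subst ha hb
  simp only [mul_add, add_mul, sub_mul, mul_smul_comm, smul_mul_assoc, Matrix.mul_vecMulVec,
    Matrix.vecMulVec_mul, star_sub, star_add, star_smul,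
    Matrix.sub_vecMulVec, Matrix.smul_vecMulVec, Matrix.vecMulVec_sub, Matrix.add_vecMulVec,
    Matrix.vecMulVec_add, Matrix.vecMulVec_smul,
    Matrix.star_mulVec, star_mul', Complex.conj_conj, hk, Complex.star_def, Complex.conj_I,
    map_div₀, map_one, map_ofNat]
  match_scalars <;> ring_nf

end

/-! ### The two derivatives of the transformed solution. -/

section
open scoped Matrix.Norms.Operator
variable {n : ℕ}

/-- Derivative of `η₂† Ω⁻¹ η₁` in the direction of `x`. -/
theorem hasDerivAt_toBilin_inv_derivX {Γ : Matrix (Fin n) (Fin n) ℂ}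
    {T : Matrix (Fin n) (Fin n) ℂ →L[ℝ] Matrix (Fin n) (Fin n) ℂ}
    (hT : ∀ M, T (Γ * M + M * Γᴴ) = M)
    {a b : ℝ → Fin n → ℂ} {α β a' b' : Fin n → ℂ} {v : ℂ}
    {Ω : ℝ → Matrix (Fin n) (Fin n) ℂ} {t : ℝ}
    (hα : Γ *ᵥ α = a t) (hβ : Γ *ᵥ β = b t)
    (ha : HasDerivAt a a' t) (hb : HasDerivAt b b' t)
    (ha' : a' = v • β - (1 / 2 : ℂ) • α)
    (hb' : b' = (1 / 2 : ℂ) • β - (Complex.I * star v) • a t)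
    (hΩ : ∀ᶠ s in nhds t, Γ * Ω s + Ω s * Γᴴ =
      Complex.I • (Matrix.vecMulVec (a s) (star (a s)) * Γᴴ) + Matrix.vecMulVec (b s) (star (b s)))
    (hinv : IsUnit (Ω t)) :
    HasDerivAt (fun s => Matrix.toBilin' (Ω s)⁻¹ (star (b s)) (a s))
      (v - (1 - Complex.I * Matrix.toBilin' (Ω t)⁻¹ (star (a t)) (a t)) *
        (v * (1 - Matrix.toBilin' (Ω t)⁻¹ (star (b t)) β)
          + Matrix.toBilin' (Ω t)⁻¹ (star (b t)) α)) t := by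
  have hΩ' := hasDerivAt_of_lyapunov hT ha hb hΩ (lyapunov_derivX Γ hα hβ ha' hb')
  refine (hΩ'.toBilin_inv hinv hb.star ha).congr_deriv ?_
  have hL := toBilin_inv_of_lyapunov hΩ.self_of_nhds hinv
  have hα' : star α ᵥ* Γᴴ = star (a t) := by rw [← hα, Matrix.star_mulVec]
  have hβ' : star β ᵥ* Γᴴ = star (b t) := by rw [← hβ, Matrix.star_mulVec]
  have h1 := hL (star β) β
  have h2 := hL (star (a t)) β
  have h3 := hL (star β) α
  have h4 := hL (star (a t)) α
  rw [hβ, hβ'] at h1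
  rw [hβ] at h2
  rw [hα, hβ'] at h3
  rw [hα] at h4
  subst ha' hb'
  simp only [mul_add, add_mul, mul_smul_comm, smul_mul_assoc, toBilin_mul_vecMulVec_mul,
    map_add, map_sub, map_smul, LinearMap.add_apply, LinearMap.sub_apply, LinearMap.smul_apply,
    star_sub, star_smul, star_mul', Complex.conj_conj, Complex.star_def, Complex.conj_I, map_div₀, map_one,
    map_ofNat, smul_eq_mul]
  generalize Matrix.toBilin' (Ω t)⁻¹ = B at *
  generalize B (star (a t)) (a t) = A at *
  generalize B (star (a t)) (b t) = f at *
  generalize B (star (b t)) β = ρ at *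
  generalize B (star (b t)) α = m at *
  generalize B (star β) (a t) = p at *
  generalize B (star β) (b t) = e at *
  generalize B (star (a t) ᵥ* Γᴴ) α = y at *
  generalize B (star (a t) ᵥ* Γᴴ) β = z at *
  -- `h1`–`h4` say that `[[1-iA, f], [ip, 1-e]] * [[1-iy, z], [im, 1-ρ]] = 1`. The claim is the
  -- lower-left entry of the product in the opposite order, which is also `1`.
  have key : p * (1 - ρ) = -m * (1 - Complex.I * A) := by
    linear_combination (1 - ρ) * (1 - Complex.I * A) * h3 + Complex.I * p * (1 - ρ) * h4
      + Complex.I * m * p * h2 + m * (1 - Complex.I * A) * h1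
  linear_combination (1/2) * key

/-- Evolution in the direction of `t` of the `x`-derivative of the transformed solution. -/
theorem hasDerivAt_toBilin_inv_derivT {Γ : Matrix (Fin n) (Fin n) ℂ} (hΓ : IsUnit Γ)
    {T : Matrix (Fin n) (Fin n) ℂ →L[ℝ] Matrix (Fin n) (Fin n) ℂ}
    (hT : ∀ M, T (Γ * M + M * Γᴴ) = M)
    {a b : ℝ → Fin n → ℂ} {a' b' : Fin n → ℂ} {q k : ℂ}
    {Ω : ℝ → Matrix (Fin n) (Fin n) ℂ} {t : ℝ} (hk : k = q * star q)
    (ha : HasDerivAt a a' t) (hb : HasDerivAt b b' t)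
    (ha' : a' = (Complex.I * k) • a t - (1 / 2 : ℂ) • (Γ *ᵥ a t) + q • b t)
    (hb' : b' = (1 / 2 : ℂ) • (Γ *ᵥ b t) - (Complex.I * k) • b t
      + (Complex.I * star q) • (Γ *ᵥ a t))
    (hΩ : ∀ᶠ s in nhds t, Γ * Ω s + Ω s * Γᴴ =
      Complex.I • (Matrix.vecMulVec (a s) (star (a s)) * Γᴴ) + Matrix.vecMulVec (b s) (star (b s)))
    (hinv : IsUnit (Ω t)) {v : ℝ → ℂ} {v' q₁ : ℂ} (hv : HasDerivAt v v' t)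
    (hv' : v' = q + 2 * Complex.I * k * v t)
    (hq₁ : q₁ = q - Matrix.toBilin' (Ω t)⁻¹ (star (b t)) (a t)) :
    HasDerivAt (fun s => (1 - Complex.I * Matrix.toBilin' (Ω s)⁻¹ (star (a s)) (a s)) *
        (v s * (1 - Matrix.toBilin' (Ω s)⁻¹ (star (b s)) (Γ⁻¹ *ᵥ b s))
          + Matrix.toBilin' (Ω s)⁻¹ (star (b s)) (Γ⁻¹ *ᵥ a s)))
      (q₁ + 2 * Complex.I * (q₁ * star q₁) *
        ((1 - Complex.I * Matrix.toBilin' (Ω t)⁻¹ (star (a t)) (a t)) *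
        (v t * (1 - Matrix.toBilin' (Ω t)⁻¹ (star (b t)) (Γ⁻¹ *ᵥ b t))
          + Matrix.toBilin' (Ω t)⁻¹ (star (b t)) (Γ⁻¹ *ᵥ a t)))) t := by
  have hd : IsUnit Γ.det := (Matrix.isUnit_iff_isUnit_det Γ).1 hΓ
  have hks : star k = k := by rw [hk, star_mul', star_star, mul_comm]
  have hΩ' := hasDerivAt_of_lyapunov hT ha hb hΩ (lyapunov_derivT Γ hks ha' hb')
  have hα := (hasDerivAt_const t Γ⁻¹).matrix_mulVec ha
  have hβ := (hasDerivAt_const t Γ⁻¹).matrix_mulVec hb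
  have hA := hΩ'.toBilin_inv hinv ha.star ha
  have hm := hΩ'.toBilin_inv hinv hb.star hα
  have hr := hΩ'.toBilin_inv hinv hb.star hβ
  refine (((hA.const_mul Complex.I).const_sub 1).mul
    ((hv.mul (hr.const_sub 1)).add hm)).congr_deriv ?_
  have hL := toBilin_inv_of_lyapunov hΩ.self_of_nhds hinv
  have hconj := star_toBilin_inv_of_lyapunov hT hΩ.self_of_nhds hinv
  have hc2 := hconj (b t)
  have cancel : ∀ y, Γ *ᵥ (Γ⁻¹ *ᵥ y) = y := fun y => by
    rw [Matrix.mulVec_mulVec, Matrix.mul_nonsing_inv _ hd, Matrix.one_mulVec]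
  have cancel' : ∀ y, Γ⁻¹ *ᵥ (Γ *ᵥ y) = y := fun y => by
    rw [Matrix.mulVec_mulVec, Matrix.nonsing_inv_mul _ hd, Matrix.one_mulVec]
  have h1 := hL (star (b t)) (Γ⁻¹ *ᵥ a t)
  have h2 := hL (star (b t)) (Γ⁻¹ *ᵥ b t)
  have h3 := hL (star (a t)) (Γ⁻¹ *ᵥ a t)
  have h4 := hL (star (a t)) (Γ⁻¹ *ᵥ b t)
  have h5 := hL (star (a t)) (a t)
  rw [cancel] at h1 h2 h3 h4
  have hq₁s := congrArg star hq₁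
  rw [star_sub] at hq₁s
  subst ha' hb'
  simp only [Matrix.zero_mulVec, zero_add, Matrix.mulVec_add, Matrix.mulVec_sub,
    Matrix.mulVec_smul, cancel', mul_add, add_mul, mul_smul_comm, smul_mul_assoc,
    toBilin_mul_vecMulVec_mul, Matrix.star_mulVec, hks,
    map_add, map_sub, map_smul, LinearMap.add_apply, LinearMap.sub_apply, LinearMap.smul_apply,
    star_add, star_sub, star_smul, star_mul', Complex.conj_conj, Complex.star_def, Complex.conj_I,
    map_div₀, map_one, map_ofNat, smul_eq_mul]
  simp only [Complex.star_def] at hq₁s hc2 hk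
  simp only [Pi.add_apply, Pi.mul_apply]
  generalize Matrix.toBilin' (Ω t)⁻¹ = B at *
  generalize B (star (a t)) (a t) = A at *
  generalize B (star (b t)) (a t) = c at *
  generalize B (star (a t)) (b t) = f at *
  generalize B (star (b t)) (b t) = g at *
  generalize B (star (b t)) (Γ⁻¹ *ᵥ a t) = m at *
  generalize B (star (b t)) (Γ⁻¹ *ᵥ b t) = ρ at *
  generalize B (star (a t) ᵥ* Γᴴ) (Γ⁻¹ *ᵥ a t) = y at *
  generalize B (star (a t) ᵥ* Γᴴ) (Γ⁻¹ *ᵥ b t) = z at *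
  generalize B (star (b t) ᵥ* Γᴴ) (Γ⁻¹ *ᵥ a t) = Y at *
  generalize B (star (b t) ᵥ* Γᴴ) (Γ⁻¹ *ᵥ b t) = Z at *
  rw [hq₁s, hv', hq₁, hk]
  generalize (starRingEnd ℂ) q = qc at *
  generalize (starRingEnd ℂ) c = cc at *
  -- The first line treats the derivative of `1 - iA`, the other two the terms with and without `v`
  -- in the second factor. `hc2` brings in the conjugate of `c`, needed for `|u'|²`.
  linear_combination (v t * (1 - ρ) + m) * ((Complex.I / 2) * h5 + Complex.I * (q - c) * hc2)
    + v t * (Complex.I * (q - c) * h4 - (1 - Complex.I * A) / 2 * h2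
      + Complex.I * (q - c) * (1 - ρ) * hc2)
    + ((1 - Complex.I * A) / 2 * h1 - Complex.I * (q - c) * h3 + Complex.I * (q - c) * m * hc2)
end

/-! ### Smoothness of `Ω` and of `u'`. -/

section
open scoped Matrix.Norms.Operator
variable {n : ℕ}

theorem contDiffOn_of_lyapunov {Γ : Matrix (Fin n) (Fin n) ℂ}
    {T : Matrix (Fin n) (Fin n) ℂ →L[ℝ] Matrix (Fin n) (Fin n) ℂ}
    (hT : ∀ M, T (Γ * M + M * Γᴴ) = M) {D : Set (ℝ × ℝ)}
    {a b : ℝ × ℝ → Fin n → ℂ} {Ω : ℝ × ℝ → Matrix (Fin n) (Fin n) ℂ}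
    (ha : ContDiffOn ℝ ∞ a D) (hb : ContDiffOn ℝ ∞ b D)
    (hΩ : ∀ p ∈ D, Γ * Ω p + Ω p * Γᴴ =
      Complex.I • (Matrix.vecMulVec (a p) (star (a p)) * Γᴴ)
        + Matrix.vecMulVec (b p) (star (b p))) :
    ContDiffOn ℝ ∞ Ω D := by
  have hv : ∀ c : ℝ × ℝ → Fin n → ℂ, ContDiffOn ℝ ∞ c D →
      ContDiffOn ℝ ∞ (fun p => Matrix.vecMulVec (c p) (star (c p))) D := by
    intro c hc
    have h : ContDiffOn (F := Fin n → Fin n → ℂ) ℝ ∞ (fun p i j => c p i * star (c p j)) D :=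
      contDiffOn_pi.2 fun i => contDiffOn_pi.2 fun j =>
        (contDiffOn_pi.1 hc i).mul ((starL' ℝ (A := ℂ)).contDiff.comp_contDiffOn
          (contDiffOn_pi.1 hc j))
    let R : (Fin n → Fin n → ℂ) →L[ℝ] Matrix (Fin n) (Fin n) ℂ :=
      LinearMap.toContinuousLinearMap (Matrix.ofLinearEquiv ℝ).toLinearMap
    exact R.contDiff.comp_contDiffOn h
  refine (T.contDiff.comp_contDiffOn
    ((((hv a ha).mul (contDiffOn_const (c := Γᴴ))).const_smul Complex.I).add (hv b hb))).congr ?_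
  intro p hp
  rw [← hT (Ω p), hΩ p hp]
  rfl

theorem contDiffOn_darbouxTransform {D U : Set (ℝ × ℝ)} (hUD : U ⊆ D)
    {u : ℝ × ℝ → ℂ} {a b : ℝ × ℝ → Fin n → ℂ} {Ω : ℝ × ℝ → Matrix (Fin n) (Fin n) ℂ}
    (hu : ContDiffOn ℝ ∞ u D) (ha : ContDiffOn ℝ ∞ a D) (hb : ContDiffOn ℝ ∞ b D)
    (hΩ : ContDiffOn ℝ ∞ Ω D) (hinv : ∀ p ∈ U, IsUnit (Ω p)) :
    ContDiffOn ℝ ∞ (darbouxTransform u a b Ω) U := by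
  have hW : ContDiffOn ℝ ∞ (fun p => (Ω p)⁻¹) U := by
    intro p hp
    obtain ⟨w, hw⟩ := hinv p hp
    have h1 := contDiffAt_ringInverse ℝ (n := ∞) w
    rw [hw] at h1
    simp only [Matrix.nonsing_inv_eq_ringInverse]
    exact h1.comp_contDiffWithinAt p (hΩ.mono hUD p hp)
  have hent : ∀ i j, ContDiffOn ℝ ∞ (fun p => (Ω p)⁻¹ i j) U := by
    intro i j
    let R : Matrix (Fin n) (Fin n) ℂ →L[ℝ] ℂ :=
      LinearMap.toContinuousLinearMap (Matrix.entryLinearMap ℝ ℂ i j)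
    exact R.contDiff.comp_contDiffOn hW
  refine (hu.mono hUD).sub ?_
  simp only [dotProduct, Matrix.mulVec]
  refine ContDiffOn.sum fun i _ => ContDiffOn.mul ?_ (ContDiffOn.sum fun j _ => ?_)
  · exact (starL' ℝ (A := ℂ)).contDiff.comp_contDiffOn (contDiffOn_pi.1 (hb.mono hUD) i)
  · exact (hent i j).mul (contDiffOn_pi.1 (ha.mono hUD) j)

end

/-! ### Partial derivatives of smooth functions. -/

section
variable {E : Type*} [NormedAddCommGroup E] [NormedSpace ℝ E]

theorem DifferentiableAt.hasDerivAt_partialX {f : ℝ × ℝ → E} {p : ℝ × ℝ}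
    (hf : DifferentiableAt ℝ f p) :
    HasDerivAt (fun s => f (s, p.2)) (partialX f p) p.1 :=
  (DifferentiableAt.comp (f := fun s : ℝ => (s, p.2)) p.1 hf (by fun_prop)).hasDerivAt

theorem DifferentiableAt.hasDerivAt_partialT {f : ℝ × ℝ → E} {p : ℝ × ℝ}
    (hf : DifferentiableAt ℝ f p) :
    HasDerivAt (fun s => f (p.1, s)) (partialT f p) p.2 :=
  (DifferentiableAt.comp (f := fun s : ℝ => (p.1, s)) p.2 hf (by fun_prop)).hasDerivAt

theorem DifferentiableAt.partialX_eq {f : ℝ × ℝ → E} {p : ℝ × ℝ}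
    (hf : DifferentiableAt ℝ f p) : partialX f p = fderiv ℝ f p (1, 0) := by
  have h : HasDerivAt (fun s : ℝ => (s, p.2)) ((1 : ℝ), (0 : ℝ)) p.1 :=
    (hasDerivAt_id p.1).prodMk (hasDerivAt_const p.1 p.2)
  exact (hf.hasFDerivAt.comp_hasDerivAt (f := fun s : ℝ => (s, p.2)) p.1 h).deriv

theorem ContDiffOn.differentiableAt_partialX {f : ℝ × ℝ → E} {D : Set (ℝ × ℝ)} (hD : IsOpen D)
    (hf : ContDiffOn ℝ ∞ f D) {p : ℝ × ℝ} (hp : p ∈ D) : DifferentiableAt ℝ (partialX f) p := by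
  have h1 : ContDiffOn ℝ 1 (fderiv ℝ f) D :=
    hf.fderiv_of_isOpen hD (by norm_cast)
  have h2 : DifferentiableAt ℝ (fun x => fderiv ℝ f x (1, 0)) p :=
    ((h1.differentiableOn (by simp)).differentiableAt (hD.mem_nhds hp)).clm_apply (by fun_prop)
  refine h2.congr_of_eventuallyEq ?_
  filter_upwards [hD.mem_nhds hp] with x hx
  exact ((hf.differentiableOn (by simp)).differentiableAt (hD.mem_nhds hx)).partialX_eq

end

/-! ### The Darboux transformation. -/

theorem theorem4 {n : ℕ} (Γ : Matrix (Fin n) (Fin n) ℂ) (hΓ : IsUnit Γ)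
    (hspec : ¬ ∃ μ : ℂ, Module.End.HasEigenvalue (Matrix.toLin' Γ) μ ∧
      Module.End.HasEigenvalue (Matrix.toLin' (-Γᴴ)) μ)
    (D : Set (ℝ × ℝ)) (hD : IsOpen D)
    (u : ℝ × ℝ → ℂ) (hu : IsFokasLenellsSolutionOn D u)
    (η₁ η₂ : ℝ × ℝ → Fin n → ℂ) (hη : IsLinearSystemSolutionOn D Γ u η₁ η₂)
    (Ω : ℝ × ℝ → Matrix (Fin n) (Fin n) ℂ)
    (hΩ : ∀ p ∈ D, Γ * Ω p + Ω p * Γᴴ =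
      Complex.I • (Matrix.vecMulVec (η₁ p) (star (η₁ p)) * Γᴴ)
        + Matrix.vecMulVec (η₂ p) (star (η₂ p)))
    (U : Set (ℝ × ℝ)) (hU : IsOpen U) (hUD : U ⊆ D) (hinv : ∀ p ∈ U, IsUnit (Ω p)) :
    IsFokasLenellsSolutionOn U (darbouxTransform u η₁ η₂ Ω) := by
  obtain ⟨T, hT⟩ := exists_sylvester_leftInverse Γ hspec
  have hd : IsUnit Γ.det := (Matrix.isUnit_iff_isUnit_det Γ).1 hΓ
  have cancel : ∀ y, Γ *ᵥ (Γ⁻¹ *ᵥ y) = y := fun y => by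
    rw [Matrix.mulVec_mulVec, Matrix.mul_nonsing_inv _ hd, Matrix.one_mulVec]
  have cancel' : ∀ y, Γ⁻¹ *ᵥ (Γ *ᵥ y) = y := fun y => by
    rw [Matrix.mulVec_mulVec, Matrix.nonsing_inv_mul _ hd, Matrix.one_mulVec]
  have hdu : ∀ p ∈ D, DifferentiableAt ℝ u p := fun p hp =>
    (hu.1.differentiableOn (by simp)).differentiableAt (hD.mem_nhds hp)
  have hd₁ : ∀ p ∈ D, DifferentiableAt ℝ η₁ p := fun p hp =>
    (hη.smooth₁.differentiableOn (by simp)).differentiableAt (hD.mem_nhds hp)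
  have hd₂ : ∀ p ∈ D, DifferentiableAt ℝ η₂ p := fun p hp =>
    (hη.smooth₂.differentiableOn (by simp)).differentiableAt (hD.mem_nhds hp)
  have lineX : ∀ p : ℝ × ℝ, p ∈ U → ∀ᶠ s in nhds p.1, (s, p.2) ∈ U := fun p hp =>
    (show ContinuousAt (fun s : ℝ => (s, p.2)) p.1 by fun_prop).preimage_mem_nhds
      (hU.mem_nhds hp)
  have lineT : ∀ p : ℝ × ℝ, p ∈ U → ∀ᶠ s in nhds p.2, (p.1, s) ∈ U := fun p hp =>
    (show ContinuousAt (fun s : ℝ => (p.1, s)) p.2 by fun_prop).preimage_mem_nhds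
      (hU.mem_nhds hp)
  have hX : ∀ p ∈ U, partialX (darbouxTransform u η₁ η₂ Ω) p =
      (1 - Complex.I * Matrix.toBilin' (Ω p)⁻¹ (star (η₁ p)) (η₁ p)) *
        (partialX u p * (1 - Matrix.toBilin' (Ω p)⁻¹ (star (η₂ p)) (Γ⁻¹ *ᵥ η₂ p))
          + Matrix.toBilin' (Ω p)⁻¹ (star (η₂ p)) (Γ⁻¹ *ᵥ η₁ p)) := by
    intro p hp
    have e₁ : partialX η₁ p = partialX u p • (Γ⁻¹ *ᵥ η₂ p) - (1 / 2 : ℂ) • (Γ⁻¹ *ᵥ η₁ p) := by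
      have h : Γ *ᵥ partialX η₁ p = partialX u p • η₂ p - (1 / 2 : ℂ) • η₁ p := by
        linear_combination (exp := 1) hη.eq_x₁ p (hUD hp)
      rw [← cancel' (partialX η₁ p), h, Matrix.mulVec_sub, Matrix.mulVec_smul, Matrix.mulVec_smul]
    have e₂ : partialX η₂ p =
        (1 / 2 : ℂ) • (Γ⁻¹ *ᵥ η₂ p) - (Complex.I * star (partialX u p)) • η₁ p := by
      have h : Γ *ᵥ partialX η₂ p =
          (1 / 2 : ℂ) • η₂ p - (Complex.I * star (partialX u p)) • (Γ *ᵥ η₁ p) := by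
        linear_combination (exp := 1) hη.eq_x₂ p (hUD hp)
      rw [← cancel' (partialX η₂ p), h, Matrix.mulVec_sub, Matrix.mulVec_smul, Matrix.mulVec_smul,
        cancel']
    have h := hasDerivAt_toBilin_inv_derivX hT (a := fun s => η₁ (s, p.2))
      (b := fun s => η₂ (s, p.2)) (Ω := fun s => Ω (s, p.2)) (t := p.1)
      (cancel (η₁ p)) (cancel (η₂ p)) (hd₁ p (hUD hp)).hasDerivAt_partialX
      (hd₂ p (hUD hp)).hasDerivAt_partialX e₁ e₂
      ((lineX p hp).mono fun s hs => hΩ _ (hUD hs)) (hinv p hp)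
    have h' := (hdu p (hUD hp)).hasDerivAt_partialX.sub h
    refine (HasDerivAt.deriv (h'.congr_of_eventuallyEq ?_)).trans ?_
    · refine Filter.Eventually.of_forall fun s => ?_
      simp [darbouxTransform, Matrix.toBilin'_apply']
    · ring
  refine ⟨contDiffOn_darbouxTransform hUD hu.1 hη.smooth₁ hη.smooth₂
    (contDiffOn_of_lyapunov hT hη.smooth₁ hη.smooth₂ hΩ) hinv, fun p hp => ?_⟩
  have norm_sq : ∀ z : ℂ, (‖z‖ : ℂ) ^ 2 = z * star z := fun z => (Complex.mul_conj' z).symm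
  have e₁ : partialT η₁ p = (Complex.I * (‖u p‖ : ℂ) ^ 2) • η₁ p
      - (1 / 2 : ℂ) • (Γ *ᵥ η₁ p) + u p • η₂ p := by
    have h := hη.eq_t₁ p (hUD hp)
    rw [Matrix.sub_mulVec, Matrix.smul_mulVec, Matrix.smul_mulVec, Matrix.one_mulVec] at h
    linear_combination (exp := 1) h
  have e₂ : partialT η₂ p = (1 / 2 : ℂ) • (Γ *ᵥ η₂ p) - (Complex.I * (‖u p‖ : ℂ) ^ 2) • η₂ p
      + (Complex.I * star (u p)) • (Γ *ᵥ η₁ p) := by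
    have h := hη.eq_t₂ p (hUD hp)
    rw [Matrix.sub_mulVec, Matrix.smul_mulVec, Matrix.smul_mulVec, Matrix.one_mulVec] at h
    linear_combination (exp := 1) h
  have hDT : darbouxTransform u η₁ η₂ Ω p =
      u p - Matrix.toBilin' (Ω p)⁻¹ (star (η₂ p)) (η₁ p) := by
    rw [Matrix.toBilin'_apply']; rfl
  have h := hasDerivAt_toBilin_inv_derivT hΓ hT (a := fun s => η₁ (p.1, s))
    (b := fun s => η₂ (p.1, s)) (Ω := fun s => Ω (p.1, s)) (t := p.2)
    (norm_sq (u p)) (hd₁ p (hUD hp)).hasDerivAt_partialT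
    (hd₂ p (hUD hp)).hasDerivAt_partialT e₁ e₂
    ((lineT p hp).mono fun s hs => hΩ _ (hUD hs)) (hinv p hp)
    (hu.1.differentiableAt_partialX hD (hUD hp)).hasDerivAt_partialT
    (by linear_combination hu.2 p (hUD hp)) hDT
  -- `hX` holds along the `t`-line near `p` because `U` is open, so its right side may be
  -- differentiated instead.
  have hXT : partialT (partialX (darbouxTransform u η₁ η₂ Ω)) p = _ :=
    (h.congr_of_eventuallyEq ((lineT p hp).mono fun s hs => hX _ hs)).deriv
  rw [hXT, hX p hp, norm_sq]
  ring
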